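/- Let $\mathbb D=\{z\in\mathbb C:|z|<1\}$ and let $\mathcal K$ be the class of (normalized) convex univalent functions, i.e. of analytic functions $f$ in $\mathbb D$ with $f(0)=0$, $f'(0)=1$, $f'\neq 0$ in $\mathbb D$ and $\mathrm{Re}\{1+zf''(z)/f'(z)\}>0$ for all $z\in\mathbb D$. For $|\zeta|\le 1$ and $f(z)=\sum_{n\ge1}a_nz^n$ analytic in $\mathbb D$ put $$\mathrm d_\zeta f(z)=\frac1z\Big\{f(z)*\frac{z}{(1-\zeta z)(1-z)}\Big\},\quad z\in\mathbb D\setminus\{0\},\qquad \mathrm d_\zeta f(0)=f'(0),$$ where $*$ is the Hadamard product $\big(\sum_n a_nz^n\big)*\big(\sum_n b_nz^n\big)=\sum_n a_nb_nz^n$ of power series; that is, $\mathrm d_\zeta f(z)=\sum_{n\ge1}(1+\zeta+\dots+\zeta^{n-1})a_nz^{n-1}$. If $f\in\mathcal K$, then for all $z\in\mathbb D$ and all $\zeta\in\mathbb C$ with $|\zeta|\le1$, $\zeta\ne1$, $$\mathrm{Re}\left\{\frac{f'(z)}{(1-\zeta)\,\mathrm d_\zeta f(z)}\right\}>\frac{1-|\zeta|^2}{2(1-2\,\mathrm{Re}\,\zeta+|\zeta|^2)}=\frac{1-|\zeta|^2}{2|1-\zeta|^2}.$$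 The result is best possible: there is a function $f\in\mathcal K$ such that for every $\zeta$ with $|\zeta|\le1$, $\zeta\neq1$, $$\inf_{z\in\mathbb D}\mathrm{Re}\left\{\frac{f'(z)}{(1-\zeta)\,\mathrm d_\zeta f(z)}\right\}=\frac{1-|\zeta|^2}{2|1-\zeta|^2}.$$ -/

import Mathlib

/-- The open unit disc of the complex plane. -/
def unitDiscC : Set ℂ := Metric.ball 0 1

/-- The class `𝒜`: functions analytic in the unit disc with `f 0 = 0` and `f' 0 = 1`. -/
def classA : Set (ℂ → ℂ) :=
  {f | DifferentiableOn ℂ f unitDiscC ∧ f 0 = 0 ∧ deriv f 0 = 1}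

/-- The class `𝒦` of (normalized) convex univalent functions: `f ∈ 𝒜` such that
`Re (1 + z f''(z) / f'(z)) > 0` in the unit disc. That the quotient makes sense, that is
`f' ≠ 0`, is stated explicitly. -/
def classK : Set (ℂ → ℂ) :=
  {f | f ∈ classA ∧ ∀ z ∈ unitDiscC,
    deriv f z ≠ 0 ∧ 0 < (1 + z * deriv (deriv f) z / deriv f z).re}

/-- The `n`-th Taylor coefficient of `f` at the origin. -/
noncomputable def taylorCoeffZero (f : ℂ → ℂ) (n : ℕ) : ℂ :=
  iteratedDeriv n f 0 / (n.factorial : ℂ)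

/-- The Hadamard product (convolution) `(f * g)(z) = ∑ aₙ bₙ zⁿ` of `f = ∑ aₙ zⁿ` and
`g = ∑ bₙ zⁿ`. -/
noncomputable def hadamardProduct (f g : ℂ → ℂ) (z : ℂ) : ℂ :=
  ∑' n : ℕ, taylorCoeffZero f n * taylorCoeffZero g n * z ^ n

/-- The function `h_ζ(z) = z / ((1 - ζ z)(1 - z))`. -/
noncomputable def hZeta (ζ z : ℂ) : ℂ :=
  z / ((1 - ζ * z) * (1 - z))

/-- The `ζ`-derivative `d_ζ f(z) = (1 / z) (f * h_ζ)(z)`. At `z = 0` it takes its limit value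
`f'(0)`, the first Taylor coefficient of `f * h_ζ`. -/
noncomputable def zetaDeriv (ζ : ℂ) (f : ℂ → ℂ) (z : ℂ) : ℂ :=
  if z = 0 then deriv f 0 else (1 / z) * hadamardProduct f (hZeta ζ) z

open Metric Filter Topology

/-! Convolution with `hZeta ζ` is a difference: (1 - ζ) d_ζ f(z) = (f(z) - f(ζz))/z, so the quantity
to bound is z f'(z)/(f(z) - f(ζz)). Fix z ≠ 0 and let ζ vary. Convexity puts f(ζz), for |ζ| = 1 and
ζ ≠ 1, strictly on one side of the tangent at f(z) to the image of the circle through z, so this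
quotient has positive real part there (`re_sub_div_pos_of_norm_eq`). Subtracting (1 + ζ)/(2(1 - ζ)),
whose real part vanishes on |ζ| = 1, cancels the pole at ζ = 1; the minimum principle in ζ then
gives the bound with ≤ (`re_le_re_mul_deriv_div_sub`). Strictness comes from the strong minimum
principle in z, since the inequality is strict at z = 0. For z/(1 - z) the bound is approached as z
→ -1. -/

/-! ### Minimum principles -/

/-- **Minimum principle** for the real part of a holomorphic function on a disc. -/
theorem le_re_of_forall_sphere {g : ℂ → ℂ} {r c : ℝ} (hr : r ≠ 0)
    (hg : DiffContOnCl ℂ g (ball 0 r)) (h : ∀ w : ℂ, ‖w‖ = r → c ≤ (g w).re)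
    {w : ℂ} (hw : ‖w‖ ≤ r) : c ≤ (g w).re := by
  have hd : DiffContOnCl ℂ (fun w => Complex.exp (-g w)) (ball 0 r) :=
    Complex.differentiable_exp.comp_diffContOnCl hg.neg
  have := Complex.norm_le_of_forall_mem_frontier_norm_le isBounded_ball hd (C := Real.exp (-c))
    (fun v hv => by
      rw [frontier_ball _ hr, mem_sphere_zero_iff_norm] at hv
      simpa [Complex.norm_exp] using h v hv) (z := w)
    (by rw [closure_ball _ hr]; simpa using hw)
  simpa [Complex.norm_exp] using this

/-- **Strong minimum principle** for the real part of a holomorphic function. -/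
theorem lt_re_of_forall_le_re {g : ℂ → ℂ} {U : Set ℂ} {c : ℝ} (hU : IsPreconnected U)
    (hUo : IsOpen U) (hg : DifferentiableOn ℂ g U) (h : ∀ w ∈ U, c ≤ (g w).re)
    {a : ℂ} (ha : a ∈ U) (hca : c < (g a).re) {w : ℂ} (hw : w ∈ U) : c < (g w).re := by
  refine lt_of_le_of_ne (h w hw) fun hcw => ?_
  have hd : DifferentiableOn ℂ (fun w => Complex.exp (-g w)) U := hg.neg.cexp
  have hm : IsMaxOn (norm ∘ fun w => Complex.exp (-g w)) U w := fun v hv => by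
    simpa [Complex.norm_exp, ← hcw] using h v hv
  have := Complex.norm_eqOn_of_isPreconnected_of_isMaxOn hU hUo hd hw hm ha
  simp [Complex.norm_exp, ← hcw] at this
  exact hca.ne' this

/-! ### The ζ-derivative as a difference quotient -/

theorem isOpen_unitDiscC : IsOpen unitDiscC := isOpen_ball

theorem mem_unitDiscC {z : ℂ} : z ∈ unitDiscC ↔ ‖z‖ < 1 := mem_ball_zero_iff

theorem mul_mem_unitDiscC {ζ z : ℂ} (hζ : ‖ζ‖ ≤ 1) (hz : z ∈ unitDiscC) :
    ζ * z ∈ unitDiscC := by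
  rw [mem_unitDiscC, norm_mul] at *
  nlinarith [norm_nonneg z]

/-- Partial fractions: h_ζ(z) = (1/(1 - z) - 1/(1 - ζz))/(1 - ζ), a difference of geometric series.
-/
theorem taylorCoeffZero_hZeta {ζ : ℂ} (hζ : ζ ≠ 1) (n : ℕ) :
    taylorCoeffZero (hZeta ζ) n = (1 - ζ ^ n) / (1 - ζ) := by
  have hζ' : 1 - ζ ≠ 0 := sub_ne_zero.2 hζ.symm
  have h1 := (spectrum.hasFPowerSeriesOnBall_inverse_one_sub_smul ℂ (1 : ℂ)).hasFPowerSeriesAt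
  have h2 := (spectrum.hasFPowerSeriesOnBall_inverse_one_sub_smul ℂ ζ).hasFPowerSeriesAt
  have h3 := (h1.sub h2).const_smul (c := (1 - ζ)⁻¹)
  have h4 : HasFPowerSeriesAt (hZeta ζ) _ 0 := h3.congr (by
    have e1 : ∀ᶠ z : ℂ in 𝓝 0, 1 - z ≠ 0 :=
      ContinuousAt.eventually_ne (by fun_prop) (by simp)
    have e2 : ∀ᶠ z : ℂ in 𝓝 0, 1 - ζ * z ≠ 0 :=
      ContinuousAt.eventually_ne (by fun_prop) (by simp)
    filter_upwards [e1, e2] with z hz1 hz2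
    have hz2' : 1 - z * ζ ≠ 0 := by rwa [mul_comm z]
    simp only [Pi.smul_apply, Pi.sub_apply, smul_eq_mul, Ring.inverse_eq_inv', hZeta, mul_one]
    field_simp
    ring)
  have h5 := h4.analyticAt.hasFPowerSeriesAt.eq_formalMultilinearSeries h4
  have h6 := congrArg (fun p => p.coeff n) h5
  simp only [FormalMultilinearSeries.coeff_ofScalars] at h6
  rw [taylorCoeffZero, h6]
  change (1 - ζ)⁻¹ * (ContinuousMultilinearMap.mkPiRing ℂ (Fin n) ((1 : ℂ) ^ n) 1
    - ContinuousMultilinearMap.mkPiRing ℂ (Fin n) (ζ ^ n) 1) = _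
  simp only [ContinuousMultilinearMap.mkPiRing_apply]
  simp
  field_simp

theorem hasSum_taylorCoeffZero {f : ℂ → ℂ} (hf : DifferentiableOn ℂ f unitDiscC) {z : ℂ}
    (hz : z ∈ unitDiscC) : HasSum (fun n => taylorCoeffZero f n * z ^ n) (f z) := by
  have := Complex.hasSum_taylorSeries_on_ball (f := f) (c := 0) (r := 1) (z := z)
    (by simpa [unitDiscC] using hf) (by simpa [unitDiscC] using hz)
  have e : (fun n => taylorCoeffZero f n * z ^ n) =
      fun n => ((n.factorial : ℂ))⁻¹ • (z - 0) ^ n • iteratedDeriv n f 0 := by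
    ext n
    simp only [taylorCoeffZero, smul_eq_mul, sub_zero]
    ring
  rwa [e]

theorem one_sub_mul_zetaDeriv {f : ℂ → ℂ} (hf : DifferentiableOn ℂ f unitDiscC) {z ζ : ℂ}
    (hz : z ∈ unitDiscC) (hz0 : z ≠ 0) (hζ : ‖ζ‖ ≤ 1) (hζ1 : ζ ≠ 1) :
    (1 - ζ) * zetaDeriv ζ f z = (f z - f (ζ * z)) / z := by
  have hζ' : 1 - ζ ≠ 0 := sub_ne_zero.2 hζ1.symm
  have h := ((hasSum_taylorCoeffZero hf hz).sub
    (hasSum_taylorCoeffZero hf (mul_mem_unitDiscC hζ hz))).mul_left (1 - ζ)⁻¹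
  have h2 : hadamardProduct f (hZeta ζ) z = (1 - ζ)⁻¹ * (f z - f (ζ * z)) := by
    rw [← h.tsum_eq, hadamardProduct]
    refine tsum_congr fun n => ?_
    rw [taylorCoeffZero_hZeta hζ1]
    rw [mul_pow]
    field_simp
  rw [zetaDeriv, if_neg hz0, h2]
  field_simp

theorem zetaDeriv_zero (f : ℂ → ℂ) (ζ : ℂ) : zetaDeriv ζ f 0 = deriv f 0 := if_pos rfl

/-! ### Supporting lines and univalence -/

/-- A nowhere vanishing holomorphic function on the unit disc has a holomorphic logarithm. -/
theorem exists_exp_eq_of_ne_zero {f : ℂ → ℂ} (hf : DifferentiableOn ℂ f unitDiscC)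
    (h0 : ∀ z ∈ unitDiscC, f z ≠ 0) :
    ∃ g : ℂ → ℂ, (∀ z ∈ unitDiscC, HasDerivAt g (deriv f z / f z) z) ∧
      ∀ z ∈ unitDiscC, f z = Complex.exp (g z) := by
  have hd : DifferentiableOn ℂ (fun z => deriv f z / f z) (ball 0 1) :=
    (hf.deriv isOpen_unitDiscC).div hf h0
  have h00 : (0 : ℂ) ∈ unitDiscC := by simp [mem_unitDiscC]
  obtain ⟨g, hg⟩ := hd.isExactOn_ball.with_val_at 0 (Complex.log (f 0))
  refine ⟨g, hg.2, fun z hz => ?_⟩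
  have hq : ∀ z ∈ unitDiscC, HasDerivAt (fun z => f z * Complex.exp (-g z)) 0 z := by
    intro z hz
    have h1 := (hf.differentiableAt (isOpen_unitDiscC.mem_nhds hz)).hasDerivAt
    refine (h1.mul (hg.2 z hz).neg.cexp).congr_deriv ?_
    have := h0 z hz
    simp only [Pi.neg_apply]
    field_simp
    ring
  have hc : f z * Complex.exp (-g z) = f 0 * Complex.exp (-g 0) :=
    (convex_ball (0 : ℂ) 1).is_const_of_fderivWithin_eq_zero (𝕜 := ℂ)
      (f := fun z => f z * Complex.exp (-g z))
      (fun z hz => (hq z hz).differentiableAt.differentiableWithinAt)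
      (fun z hz => by
        rw [fderivWithin_of_isOpen isOpen_ball hz]
        ext
        simpa using (hq z hz).deriv) hz h00
  rw [hg.1, Complex.exp_neg, Complex.exp_neg, Complex.exp_log (h0 0 h00),
    mul_inv_cancel₀ (h0 0 h00)] at hc
  field_simp at hc
  simpa using hc

theorem hasDerivAt_mul_exp_mul_I (z : ℂ) (t : ℝ) :
    HasDerivAt (fun t : ℝ => z * Complex.exp (t * Complex.I))
      (Complex.I * (z * Complex.exp (t * Complex.I))) t := by
  have h := (((hasDerivAt_id (t : ℂ)).comp_ofReal.mul_const Complex.I).cexp).const_mul z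
  convert! h using 1
  simp
  ring

/-- **Supporting line property**: the image of a circle under a convex function lies strictly on
one side of each of its tangents. -/
theorem re_sub_div_pos_of_norm_eq {f : ℂ → ℂ} (hf : f ∈ classK) {z w : ℂ} (hz : z ∈ unitDiscC)
    (hzw : ‖w‖ = ‖z‖) (hne : w ≠ z) : 0 < ((f z - f w) / (z * deriv f z)).re := by
  obtain ⟨⟨hd, -, -⟩, hc⟩ := hf
  have hz0 : z ≠ 0 := by
    rintro rfl
    exact hne (by simpa using hzw)
  obtain ⟨g, hg, hexp⟩ := exists_exp_eq_of_ne_zero (hd.deriv isOpen_unitDiscC)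
    (fun z hz => (hc z hz).1)
  set γ : ℝ → ℂ := fun t => z * Complex.exp (t * Complex.I) with hγ
  have hγm : ∀ t, γ t ∈ unitDiscC := fun t => by
    rw [mem_unitDiscC] at *
    simpa [hγ, Complex.norm_exp] using hz
  have hγ' : ∀ t, HasDerivAt γ (Complex.I * γ t) t := hasDerivAt_mul_exp_mul_I z
  have hγ0 : γ 0 = z := by simp [hγ]
  have hγ1 : γ (2 * Real.pi) = z := by simp [hγ, Complex.exp_two_pi_mul_I]
  -- A continuous argument of γ f'(γ)/(z f'(z)): the angle through which the tangent of f ∘ γ has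
  -- turned. Its derivative is the expression in the definition of `classK`.
  set ψ : ℝ → ℝ := fun t => t + (g (γ t) - g z).im with hψ
  have hψ' : ∀ t, HasDerivAt ψ (1 + γ t * deriv (deriv f) (γ t) / deriv f (γ t)).re t := by
    intro t
    have h1 : HasDerivAt (fun t => g (γ t) - g z)
        (deriv (deriv f) (γ t) / deriv f (γ t) * (Complex.I * γ t)) t :=
      ((hg _ (hγm t)).comp_of_eq t (hγ' t) rfl).sub_const _
    have h2 := (Complex.imCLM.hasFDerivAt.comp_hasDerivAt t h1)
    convert! (hasDerivAt_id t).add h2 using 1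
    rw [show deriv (deriv f) (γ t) / deriv f (γ t) * (Complex.I * γ t)
      = Complex.I * (γ t * deriv (deriv f) (γ t) / deriv f (γ t)) by ring]
    simp
  have hψmono : StrictMono ψ := strictMono_of_deriv_pos fun t => by
    rw [(hψ' t).deriv]
    exact (hc _ (hγm t)).2
  have hψc : Continuous ψ := continuous_iff_continuousAt.2 fun t => (hψ' t).continuousAt
  have hψ0 : ψ 0 = 0 := by simp [hψ, hγ0]
  have hψ1 : ψ (2 * Real.pi) = 2 * Real.pi := by simp only [hψ, hγ1]; simp
  set h : ℝ → ℝ := fun t => (f (γ t) / (z * deriv f z)).re with hh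
  have hh' : ∀ t, HasDerivAt h (-(Real.exp (g (γ t) - g z).re * Real.sin (ψ t))) t := by
    intro t
    have h1 : HasDerivAt (fun t => f (γ t) / (z * deriv f z))
        (deriv f (γ t) * (Complex.I * γ t) / (z * deriv f z)) t :=
      (((hd.differentiableAt (isOpen_unitDiscC.mem_nhds (hγm t))).hasDerivAt).comp_of_eq t
        (hγ' t) rfl).div_const _
    have h2 := (Complex.reCLM.hasFDerivAt.comp_hasDerivAt t h1)
    convert! h2 using 1
    have e : deriv f (γ t) * (Complex.I * γ t) / (z * deriv f z)
        = Complex.I * Complex.exp (t * Complex.I + (g (γ t) - g z)) := by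
      rw [hexp _ (hγm t), hexp z hz, Complex.exp_add, Complex.exp_sub, hγ]
      have := Complex.exp_ne_zero (g z)
      field_simp
    rw [e]
    simp [Complex.exp_im, hψ]
  have hhc : Continuous h := continuous_iff_continuousAt.2 fun t => (hh' t).continuousAt
  -- At s the tangent has turned by half a revolution; h falls before s and rises after it, so its
  -- maximum is at the endpoints only.
  obtain ⟨s, hs, hψs⟩ : ∃ s ∈ Set.Icc 0 (2 * Real.pi), ψ s = Real.pi :=
    intermediate_value_Icc (by positivity) hψc.continuousOn
      (by rw [hψ0, hψ1]; constructor <;> linarith [Real.pi_pos])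
  have hanti : StrictAntiOn h (Set.Icc 0 s) :=
    strictAntiOn_of_deriv_neg (convex_Icc _ _) hhc.continuousOn fun t ht => by
      rw [interior_Icc] at ht
      rw [(hh' t).deriv]
      have : 0 < Real.sin (ψ t) := Real.sin_pos_of_pos_of_lt_pi
        (hψ0 ▸ hψmono ht.1) (hψs ▸ hψmono ht.2)
      have := Real.exp_pos (g (γ t) - g z).re
      simp only [Left.neg_neg_iff]
      positivity
  have hmono : StrictMonoOn h (Set.Icc s (2 * Real.pi)) :=
    strictMonoOn_of_deriv_pos (convex_Icc _ _) hhc.continuousOn fun t ht => by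
      rw [interior_Icc] at ht
      rw [(hh' t).deriv]
      have h1 := hψmono ht.1
      have h2 := hψmono ht.2
      have : 0 < Real.sin (ψ t - Real.pi) := Real.sin_pos_of_pos_of_lt_pi
        (by linarith) (by linarith)
      rw [Real.sin_sub_pi] at this
      have := Real.exp_pos (g (γ t) - g z).re
      nlinarith
  have key : ∀ t ∈ Set.Ioo 0 (2 * Real.pi), h t < h 0 := by
    intro t ht
    rcases le_total t s with hts | hts
    · exact hanti ⟨le_rfl, hs.1⟩ ⟨ht.1.le, hts⟩ ht.1
    · have h1 : h 0 = h (2 * Real.pi) := by simp only [hh, hγ0, hγ1]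
      rw [h1]
      exact hmono ⟨hts, ht.2.le⟩ ⟨hs.2, le_rfl⟩ ht.2
  obtain ⟨t, ht, rfl⟩ : ∃ t ∈ Set.Ioo 0 (2 * Real.pi), γ t = w := by
    have hn : ‖w / z‖ = 1 := by rw [norm_div, hzw, div_self (norm_ne_zero_iff.2 hz0)]
    have hw : z * Complex.exp ((w / z).arg * Complex.I) = w := by
      have := Complex.norm_mul_exp_arg_mul_I (w / z)
      rw [hn, Complex.ofReal_one, one_mul] at this
      rw [this]
      field_simp
    rcases lt_trichotomy (w / z).arg 0 with ha | ha | ha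
    · refine ⟨(w / z).arg + 2 * Real.pi, ⟨?_, by linarith⟩, ?_⟩
      · linarith [Complex.neg_pi_lt_arg (w / z), Real.pi_pos]
      · simp only [hγ]
        push_cast
        rw [add_mul, Complex.exp_add, Complex.exp_two_pi_mul_I, mul_one, hw]
    · rw [ha] at hw
      exact absurd (by simpa using hw.symm) hne
    · exact ⟨_, ⟨ha, by linarith [Complex.arg_le_pi (w / z), Real.pi_pos]⟩, hw⟩
  have := key t ht
  rw [sub_div, Complex.sub_re]
  simp only [hh, hγ0] at this
  linarith

theorem mul_deriv_ne_zero {f : ℂ → ℂ} (hf : f ∈ classK) {z : ℂ} (hz : z ∈ unitDiscC)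
    (hz0 : z ≠ 0) : z * deriv f z ≠ 0 :=
  mul_ne_zero hz0 (hf.2 z hz).1

theorem re_sub_div_pos {f : ℂ → ℂ} (hf : f ∈ classK) {z w : ℂ} (hz : z ∈ unitDiscC)
    (hzw : ‖w‖ ≤ ‖z‖) (hne : w ≠ z) : 0 < ((f z - f w) / (z * deriv f z)).re := by
  rcases hzw.eq_or_lt with h | h
  · exact re_sub_div_pos_of_norm_eq hf hz h hne
  have hz0 : ‖z‖ ≠ 0 := ((norm_nonneg w).trans_lt h).ne'
  have hd : DifferentiableOn ℂ (fun v => (f z - f v) / (z * deriv f z)) unitDiscC :=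
    ((differentiableOn_const _).sub hf.1.1).div_const _
  have hle : ∀ v : ℂ, ‖v‖ ≤ ‖z‖ → 0 ≤ ((f z - f v) / (z * deriv f z)).re := by
    intro v hv
    refine le_re_of_forall_sphere hz0 (DifferentiableOn.diffContOnCl (hd.mono ?_))
      (fun v hv => ?_) hv
    · rw [closure_ball _ hz0]
      exact closedBall_subset_ball (mem_unitDiscC.1 hz)
    · rcases eq_or_ne v z with rfl | hvz
      · simp
      · exact (re_sub_div_pos_of_norm_eq hf hz hv hvz).le
  -- Strictness: otherwise the real part would vanish identically, hence also at `-z`.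
  by_contra hcon
  have hw0 : ((f z - f w) / (z * deriv f z)).re = 0 := le_antisymm (not_lt.1 hcon) (hle w h.le)
  have hneg : -z ≠ z := fun h => hz0 (by simpa [neg_eq_self] using h)
  have hpos := re_sub_div_pos_of_norm_eq hf hz (norm_neg z) hneg
  have hcont : ContinuousAt (fun v => ((f z - f v) / (z * deriv f z)).re) (-z) :=
    Complex.continuous_re.continuousAt.comp (hd.differentiableAt
      (isOpen_unitDiscC.mem_nhds (by simpa [mem_unitDiscC] using hz))).continuousAt
  have hcl : -z ∈ closure (ball (0 : ℂ) ‖z‖) := by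
    rw [closure_ball _ hz0]; simp
  obtain ⟨a, ha, hab⟩ := ((mem_closure_iff_frequently.1 hcl).and_eventually
    (hcont.eventually (lt_mem_nhds hpos))).exists
  exact hcon (lt_re_of_forall_le_re (convex_ball (0 : ℂ) ‖z‖).isPreconnected isOpen_ball
    (hd.mono (ball_subset_ball (mem_unitDiscC.1 hz).le))
    (fun v hv => hle v (mem_ball_zero_iff.1 hv).le) ha hab (mem_ball_zero_iff.2 h))

/-- Of two points, the one of larger modulus serves as the point of tangency. -/
theorem injOn_of_mem_classK {f : ℂ → ℂ} (hf : f ∈ classK) : Set.InjOn f unitDiscC := by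
  intro z hz w hw hzw
  by_contra hne
  rcases le_total ‖w‖ ‖z‖ with h | h
  · simpa [hzw] using re_sub_div_pos hf hz h (Ne.symm hne)
  · simpa [hzw] using re_sub_div_pos hf hw h hne

/-! ### The lower bound -/

theorem norm_one_sub_sq (ζ : ℂ) : ‖1 - ζ‖ ^ 2 = 1 - 2 * ζ.re + ‖ζ‖ ^ 2 := by
  rw [Complex.sq_norm, Complex.sq_norm, Complex.normSq_apply, Complex.normSq_apply]
  simp
  ring

theorem re_one_add_div_one_sub (ζ : ℂ) :
    ((1 + ζ) / (2 * (1 - ζ))).re = (1 - ‖ζ‖ ^ 2) / (2 * ‖1 - ζ‖ ^ 2) := by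
  rcases eq_or_ne ζ 1 with rfl | hζ
  · simp
  have h : Complex.normSq (1 - ζ) ≠ 0 := by
    simpa [sub_eq_zero] using hζ.symm
  rw [Complex.sq_norm, Complex.sq_norm, Complex.div_re]
  have h2 : Complex.normSq (2 * (1 - ζ)) = 4 * Complex.normSq (1 - ζ) := by
    simp [Complex.normSq_apply]; ring
  rw [h2]
  field_simp
  simp [Complex.normSq_apply]
  ring

theorem inv_re_pos {a : ℂ} (h : 0 < a.re) : 0 < a⁻¹.re := by
  rw [Complex.inv_re]
  exact div_pos h (Complex.normSq_pos.2 fun h0 => by simp [h0] at h)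

/-- For a convex function `f`, the real part of `z f'(z) / (f(z) - f(ζ z))` is at least
the real part of `(1 + ζ) / (2 (1 - ζ))`. -/
theorem re_le_re_mul_deriv_div_sub {f : ℂ → ℂ} (hf : f ∈ classK) {z ζ : ℂ} (hz : z ∈ unitDiscC)
    (hz0 : z ≠ 0) (hζ : ‖ζ‖ ≤ 1) (hζ1 : ζ ≠ 1) :
    ((1 + ζ) / (2 * (1 - ζ))).re ≤ (z * deriv f z / (f z - f (ζ * z))).re := by
  have hu := mul_deriv_ne_zero hf hz hz0
  set u := z * deriv f z with hu_def
  set N : ℂ → ℂ := fun ξ => f z - f (ξ * z) with hN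
  set V : Set ℂ := (fun ξ => ξ * z) ⁻¹' unitDiscC with hV
  have hVo : IsOpen V := isOpen_unitDiscC.preimage (by fun_prop)
  have hVsub : closedBall (0 : ℂ) 1 ⊆ V := fun ξ hξ =>
    mul_mem_unitDiscC (mem_closedBall_zero_iff.1 hξ) hz
  have h1V : V ∈ 𝓝 (1 : ℂ) := hVo.mem_nhds (hVsub (by simp))
  have hNd : DifferentiableOn ℂ N V :=
    (differentiableOn_const _).sub
      (hf.1.1.comp (differentiable_id.mul_const z).differentiableOn fun ξ hξ => hξ)
  set K := dslope N 1 with hK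
  have hKd : DifferentiableOn ℂ K V := (Complex.differentiableOn_dslope h1V).2 hNd
  have hNK : ∀ ξ, N ξ = (ξ - 1) * K ξ := fun ξ => by
    have := sub_smul_dslope N 1 ξ
    rw [smul_eq_mul] at this
    rw [hK, this]
    simp [hN]
  have hK1 : K 1 = -u := by
    rw [hK, dslope_same]
    have h1 : HasDerivAt (fun ξ : ℂ => ξ * z) z 1 := by
      simpa using (hasDerivAt_id (1 : ℂ)).mul_const z
    have h2 : HasDerivAt f (deriv f z) (1 * z) := by
      rw [one_mul]
      exact (hf.1.1.differentiableAt (isOpen_unitDiscC.mem_nhds hz)).hasDerivAt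
    have h3 := ((h2.comp (1 : ℂ) h1).const_sub (f z)).deriv
    rw [hu_def, mul_comm z]
    exact h3
  have hNne : ∀ ξ : ℂ, ‖ξ‖ ≤ 1 → ξ ≠ 1 → 0 < (N ξ / u).re := fun ξ hξ hξ1 => by
    refine re_sub_div_pos hf hz ?_ ?_
    · rw [norm_mul]
      nlinarith [norm_nonneg z]
    · intro h
      exact hξ1 (mul_right_cancel₀ hz0 (by rw [h, one_mul]))
  have hKne : ∀ ξ ∈ closedBall (0 : ℂ) 1, K ξ ≠ 0 := fun ξ hξ h0 => by
    rcases eq_or_ne ξ 1 with rfl | hξ1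
    · exact hu (by simpa [hK1] using h0)
    · have := hNne ξ (mem_closedBall_zero_iff.1 hξ) hξ1
      simp [hNK, h0] at this
  -- Since N = (ξ - 1)K, the difference u/N - (1 + ξ)/(2(1 - ξ)) equals M/((ξ - 1)K). As K(1) = -u,
  -- M vanishes at 1 and the pole is removable.
  set M : ℂ → ℂ := fun ξ => u + (1 + ξ) / 2 * K ξ with hM
  have hMd : DifferentiableOn ℂ M V :=
    (differentiableOn_const _).add (DifferentiableOn.mul (by fun_prop) hKd)
  set L := dslope M 1 with hL
  have hLd : DifferentiableOn ℂ L V := (Complex.differentiableOn_dslope h1V).2 hMd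
  have hML : ∀ ξ, M ξ = (ξ - 1) * L ξ := fun ξ => by
    have := sub_smul_dslope M 1 ξ
    rw [smul_eq_mul] at this
    rw [hL, this]
    simp only [hM, hK1]
    ring
  have hgd : DifferentiableOn ℂ (fun ξ => L ξ / K ξ) (closedBall 0 1) :=
    (hLd.mono hVsub).div (hKd.mono hVsub) hKne
  have hg : ∀ ξ : ℂ, ‖ξ‖ ≤ 1 → ξ ≠ 1 → L ξ / K ξ = u / N ξ - (1 + ξ) / (2 * (1 - ξ)) := by
    intro ξ hξ hξ1
    have h1 : ξ - 1 ≠ 0 := sub_ne_zero.2 hξ1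
    have h1' : 1 - ξ ≠ 0 := sub_ne_zero.2 hξ1.symm
    have h2 := hKne ξ (mem_closedBall_zero_iff.2 hξ)
    have h3 : L ξ = M ξ / (ξ - 1) := by rw [hML]; field_simp
    rw [h3, hNK, hM, show 1 - ξ = -(ξ - 1) by ring]
    field_simp
    ring
  have hsph : ∀ ξ : ℂ, ‖ξ‖ = 1 → ξ ≠ 1 → 0 ≤ (L ξ / K ξ).re := by
    intro ξ hξ hξ1
    rw [hg ξ hξ.le hξ1, Complex.sub_re, re_one_add_div_one_sub, hξ]
    have := inv_re_pos (hNne ξ hξ.le hξ1)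
    rw [inv_div] at this
    simpa using this.le
  -- The sign at the exceptional point 1 follows by continuity, approaching it along the unit
  -- circle.
  have hone : 0 ≤ (L 1 / K 1).re := by
    have hc : Continuous fun t : ℝ => Complex.exp (t * Complex.I) := by fun_prop
    have hcm : ∀ t : ℝ, ‖Complex.exp (t * Complex.I)‖ = 1 := Complex.norm_exp_ofReal_mul_I
    have ht : Tendsto (fun t : ℝ => Complex.exp (t * Complex.I)) (𝓝[>] 0)
        (𝓝[closedBall 0 1] 1) := by
      refine tendsto_nhdsWithin_iff.2 ⟨?_, Eventually.of_forall fun t => ?_⟩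
      · exact (by simpa using hc.tendsto 0 : Tendsto _ (𝓝 (0 : ℝ)) (𝓝 (1 : ℂ))).mono_left
          nhdsWithin_le_nhds
      · simp [hcm]
    have h1 := (Complex.continuous_re.tendsto _).comp
      ((hgd.continuousOn 1 (by simp)).tendsto.comp ht)
    refine ge_of_tendsto h1 ?_
    filter_upwards [Ioo_mem_nhdsGT Real.pi_pos] with t ht
    refine hsph _ (hcm t) fun h => ?_
    have := congrArg Complex.im h
    rw [Complex.exp_ofReal_mul_I_im] at this
    exact (Real.sin_pos_of_pos_of_lt_pi ht.1 ht.2).ne' (by simpa using this)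
  have := le_re_of_forall_sphere one_ne_zero
    (DifferentiableOn.diffContOnCl (by rwa [closure_ball _ one_ne_zero]))
    (fun ξ hξ => by
      rcases eq_or_ne ξ 1 with rfl | hξ1
      · exact hone
      · exact hsph ξ hξ hξ1) hζ
  rw [hg ζ hζ hζ1, Complex.sub_re] at this
  linarith

theorem re_lt_re_deriv_div_zetaDeriv {f : ℂ → ℂ} (hf : f ∈ classK) {z ζ : ℂ}
    (hz : z ∈ unitDiscC) (hζ : ‖ζ‖ ≤ 1) (hζ1 : ζ ≠ 1) :
    ((1 + ζ) / (2 * (1 - ζ))).re < (deriv f z / ((1 - ζ) * zetaDeriv ζ f z)).re := by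
  have h00 : (0 : ℂ) ∈ unitDiscC := by simp [mem_unitDiscC]
  have hζ' : 1 - ζ ≠ 0 := sub_ne_zero.2 hζ1.symm
  set q : ℂ → ℂ := fun z => f z - f (ζ * z) with hq
  have hqd : DifferentiableOn ℂ q unitDiscC :=
    hf.1.1.sub (hf.1.1.comp (differentiable_id.const_mul ζ).differentiableOn
      fun z hz => mul_mem_unitDiscC hζ hz)
  have hd : ∀ z ∈ unitDiscC, dslope q 0 z = (1 - ζ) * zetaDeriv ζ f z := by
    intro z hz
    rcases eq_or_ne z 0 with rfl | hz0
    · rw [dslope_same, zetaDeriv_zero]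
      have h1 : HasDerivAt (fun z : ℂ => ζ * z) ζ 0 := by
        simpa using (hasDerivAt_id (0 : ℂ)).const_mul ζ
      have h2 : HasDerivAt f (deriv f 0) 0 :=
        (hf.1.1.differentiableAt (isOpen_unitDiscC.mem_nhds hz)).hasDerivAt
      have h3 : HasDerivAt f (deriv f 0) (ζ * 0) := by rwa [mul_zero]
      have h4 := (h2.sub (h3.comp (0 : ℂ) h1)).deriv
      rw [show (1 - ζ) * deriv f 0 = deriv f 0 - deriv f 0 * ζ by ring]
      exact h4
    · rw [one_sub_mul_zetaDeriv hf.1.1 hz hz0 hζ hζ1, dslope_of_ne _ hz0, slope_def_field]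
      simp [hq]
  have hne : ∀ z ∈ unitDiscC, dslope q 0 z ≠ 0 := by
    intro z hz
    rw [hd z hz]
    rcases eq_or_ne z 0 with rfl | hz0
    · rw [zetaDeriv_zero]
      exact mul_ne_zero hζ' (hf.2 0 hz).1
    · rw [one_sub_mul_zetaDeriv hf.1.1 hz hz0 hζ hζ1]
      refine div_ne_zero (sub_ne_zero.2 fun h => ?_) hz0
      have := injOn_of_mem_classK hf hz (mul_mem_unitDiscC hζ hz) h
      exact hζ1 (mul_right_cancel₀ hz0 (by rw [← this, one_mul]))
  have hgd : DifferentiableOn ℂ (fun z => deriv f z / dslope q 0 z) unitDiscC :=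
    (hf.1.1.deriv isOpen_unitDiscC).div
      ((Complex.differentiableOn_dslope (isOpen_unitDiscC.mem_nhds h00)).2 hqd) hne
  have hzero : ((1 + ζ) / (2 * (1 - ζ))).re < (deriv f 0 / dslope q 0 0).re := by
    rw [hd 0 h00, zetaDeriv_zero]
    have h1 := (hf.2 0 h00).1
    -- At z = 0 the quotient is 1/(1 - ζ), which exceeds the comparison function by exactly 1/2.
    have : deriv f 0 / ((1 - ζ) * deriv f 0) = (1 + ζ) / (2 * (1 - ζ)) + (1 / 2 : ℝ) := by
      push_cast
      field_simp
      ring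
    rw [this, Complex.add_re, Complex.ofReal_re]
    linarith
  have := lt_re_of_forall_le_re (convex_ball (0 : ℂ) 1).isPreconnected isOpen_ball hgd
    (fun z hz => by
      rcases eq_or_ne z 0 with rfl | hz0
      · exact hzero.le
      · rw [hd z hz, one_sub_mul_zetaDeriv hf.1.1 hz hz0 hζ hζ1]
        convert! re_le_re_mul_deriv_div_sub hf hz hz0 hζ hζ1 using 2
        field_simp) h00 hzero hz
  rwa [hd z hz] at this

/-! ### Sharpness: the half-plane map z/(1 - z) -/

theorem one_sub_ne_zero_of_mem_unitDiscC {z : ℂ} (hz : z ∈ unitDiscC) : 1 - z ≠ 0 := by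
  rw [sub_ne_zero]
  rintro rfl
  simp [mem_unitDiscC] at hz

theorem hasDerivAt_div_one_sub {z : ℂ} (hz : z ∈ unitDiscC) :
    HasDerivAt (fun z : ℂ => z / (1 - z)) (1 / (1 - z) ^ 2) z := by
  have h := one_sub_ne_zero_of_mem_unitDiscC hz
  refine ((hasDerivAt_id z).div ((hasDerivAt_id z).const_sub 1) h).congr_deriv ?_
  simp

theorem deriv_deriv_div_one_sub {z : ℂ} (hz : z ∈ unitDiscC) :
    deriv (deriv fun z : ℂ => z / (1 - z)) z = 2 / (1 - z) ^ 3 := by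
  have h := one_sub_ne_zero_of_mem_unitDiscC hz
  have h1 : deriv (fun z : ℂ => z / (1 - z)) =ᶠ[𝓝 z] fun z => 1 / (1 - z) ^ 2 := by
    filter_upwards [isOpen_unitDiscC.mem_nhds hz] with w hw
    exact (hasDerivAt_div_one_sub hw).deriv
  rw [h1.deriv_eq]
  have h2 := (hasDerivAt_const z (1 : ℂ)).div (((hasDerivAt_id z).const_sub 1).pow 2)
    (pow_ne_zero 2 h)
  refine (h2.congr_deriv ?_).deriv
  simp
  field_simp

theorem div_one_sub_mem_classK : (fun z : ℂ => z / (1 - z)) ∈ classK := by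
  have h00 : (0 : ℂ) ∈ unitDiscC := by simp [mem_unitDiscC]
  refine ⟨⟨fun z hz => (hasDerivAt_div_one_sub hz).differentiableAt.differentiableWithinAt,
    by simp, by simp [(hasDerivAt_div_one_sub h00).deriv]⟩, fun z hz => ?_⟩
  have h := one_sub_ne_zero_of_mem_unitDiscC hz
  rw [deriv_deriv_div_one_sub hz, (hasDerivAt_div_one_sub hz).deriv]
  refine ⟨div_ne_zero one_ne_zero (pow_ne_zero 2 h), ?_⟩
  -- The convexity expression is (1 + z)/(1 - z), so the formula used for the bound also gives its
  -- positivity.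
  have e : 1 + z * (2 / (1 - z) ^ 3) / (1 / (1 - z) ^ 2) = (2 : ℝ) * ((1 + z) / (2 * (1 - z))) := by
    push_cast
    field_simp
    ring
  rw [e, Complex.re_ofReal_mul, re_one_add_div_one_sub]
  have h1 : 0 < ‖1 - z‖ := norm_pos_iff.2 h
  have h2 : 0 < 1 - ‖z‖ ^ 2 := by
    have := mem_unitDiscC.1 hz
    nlinarith [norm_nonneg z]
  positivity

theorem deriv_div_zetaDeriv_div_one_sub {z ζ : ℂ} (hz : z ∈ unitDiscC) (hζ : ‖ζ‖ ≤ 1)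
    (hζ1 : ζ ≠ 1) (hz0 : z ≠ 0) :
    deriv (fun z : ℂ => z / (1 - z)) z / ((1 - ζ) * zetaDeriv ζ (fun z : ℂ => z / (1 - z)) z)
      = (1 - ζ * z) / ((1 - z) * (1 - ζ)) := by
  have h := one_sub_ne_zero_of_mem_unitDiscC hz
  have h' := one_sub_ne_zero_of_mem_unitDiscC (mul_mem_unitDiscC hζ hz)
  have hζ' : 1 - ζ ≠ 0 := sub_ne_zero.2 hζ1.symm
  rw [one_sub_mul_zetaDeriv div_one_sub_mem_classK.1.1 hz hz0 hζ hζ1,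
    (hasDerivAt_div_one_sub hz).deriv]
  have e : z / (1 - z) - ζ * z / (1 - ζ * z) = z * (1 - ζ) / ((1 - z) * (1 - ζ * z)) := by
    rw [div_sub_div _ _ h h']
    congr 1
    ring
  rw [e]
  field_simp

theorem isGLB_re_deriv_div_zetaDeriv_div_one_sub {ζ : ℂ} (hζ : ‖ζ‖ ≤ 1) (hζ1 : ζ ≠ 1) :
    IsGLB ((fun z : ℂ => (deriv (fun z : ℂ => z / (1 - z)) z /
      ((1 - ζ) * zetaDeriv ζ (fun z : ℂ => z / (1 - z)) z)).re) '' unitDiscC)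
      ((1 + ζ) / (2 * (1 - ζ))).re := by
  have hζ' : 1 - ζ ≠ 0 := sub_ne_zero.2 hζ1.symm
  constructor
  · rintro _ ⟨z, hz, rfl⟩
    exact (re_lt_re_deriv_div_zetaDeriv div_one_sub_mem_classK hz hζ hζ1).le
  · intro b hb
    -- Along z = -r with r → 1 from below, the explicit quotient tends to (1 + ζ)/(2(1 - ζ)).
    have hc : ContinuousAt (fun r : ℝ => ((1 - ζ * (-r : ℂ)) / ((1 - (-r : ℂ)) * (1 - ζ))).re) 1 :=
      Complex.continuous_re.continuousAt.comp
        (ContinuousAt.div (by fun_prop) (by fun_prop)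
          (mul_ne_zero (by norm_num) hζ'))
    have ht := hc.tendsto.mono_left (nhdsWithin_le_nhds (s := Set.Iio 1))
    have e : (1 - ζ * (-(1 : ℝ) : ℂ)) / ((1 - (-(1 : ℝ) : ℂ)) * (1 - ζ))
        = (1 + ζ) / (2 * (1 - ζ)) := by
      push_cast
      congr 1 <;> ring
    rw [e] at ht
    refine ge_of_tendsto ht ?_
    filter_upwards [Ioo_mem_nhdsLT (zero_lt_one' ℝ)] with r hr
    have hm : (-r : ℂ) ∈ unitDiscC := by
      simpa [mem_unitDiscC, abs_of_pos hr.1] using hr.2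
    rw [← deriv_div_zetaDeriv_div_one_sub hm hζ hζ1 (by simpa using hr.1.ne')]
    exact hb ⟨_, hm, rfl⟩

theorem corollaryc550 :
    (∀ f ∈ classK, ∀ z ∈ unitDiscC, ∀ ζ : ℂ, ‖ζ‖ ≤ 1 → ζ ≠ 1 →
      (1 - ‖ζ‖ ^ 2) / (2 * (1 - 2 * ζ.re + ‖ζ‖ ^ 2))
          < (deriv f z / ((1 - ζ) * zetaDeriv ζ f z)).re ∧
        (1 - ‖ζ‖ ^ 2) / (2 * (1 - 2 * ζ.re + ‖ζ‖ ^ 2))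
          = (1 - ‖ζ‖ ^ 2) / (2 * ‖1 - ζ‖ ^ 2)) ∧
    (∃ f ∈ classK, ∀ ζ : ℂ, ‖ζ‖ ≤ 1 → ζ ≠ 1 →
      IsGLB ((fun z : ℂ => (deriv f z / ((1 - ζ) * zetaDeriv ζ f z)).re) '' unitDiscC)
        ((1 - ‖ζ‖ ^ 2) / (2 * ‖1 - ζ‖ ^ 2))) := by
  refine ⟨fun f hf z hz ζ hζ hζ1 => ?_, _, div_one_sub_mem_classK, fun ζ hζ hζ1 => ?_⟩
  · rw [← norm_one_sub_sq, ← re_one_add_div_one_sub]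
    exact ⟨re_lt_re_deriv_div_zetaDeriv hf hz hζ hζ1, rfl⟩
  · rw [← re_one_add_div_one_sub]
    exact isGLB_re_deriv_div_zetaDeriv_div_one_sub hζ hζ1
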